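/- Let $t>0$. Let $H^2=T^*\mathbb P^1(\mathbb C)=\{(\alpha,\beta,\gamma)\in(\mathbb C^2\setminus\{0\})\times\mathbb C\}/\sim$, where $(\alpha,\beta,\gamma)\sim(A\alpha,A\beta,\gamma/A^2)$ for $A\in\mathbb C^*$. Put $u_1([\alpha,\beta,\gamma])=(|\alpha|^2+|\beta|^2)|\gamma|$ and $f_t=\sqrt{u_1^2+t^4}+t^2\log\frac{u_1}{\sqrt{u_1^2+t^4}+t^2}$. The form $\omega_t=i\partial\bar\partial f_t$ extends smoothly over the zero section $\{\gamma=0\}$; let $g_t(X,Y)=\omega_t(X,JY)$ be the resulting Eguchi--Hanson metric, where $J$ is the complex structure of $H^2$. Let $p:H^2\to\mathbb P^1(\mathbb C)=\mathbb C\cup\{\infty\}$, $p([\alpha,\beta,\gamma])=\alpha/\beta$. Let $r_0>0$, let $\Gamma\subset\mathbb C$ be the circle of radius $r_0$ centred at the origin, parametrized by arc length as $s\mapsto\Gamma(s)$, and let $M^3_\Gamma=p^{-1}(\Gamma)$ carry the Riemannian metric $h_t$ induced by $g_t$. Identify $\Gamma$ with the zero section $\{[\Gamma(s),1,0]\}$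 of $M^3_\Gamma$. For $\rho_0>0$ and $s_0,\phi_0\in\mathbb R$ let $\Psi(s_0,\rho_0,\phi_0)=[\Gamma(s_0),1,(\rho_0e^{i\phi_0})^2]\in M^3_\Gamma$. Then the Riemannian distance in $(M^3_\Gamma,h_t)$ from $p_0=\Psi(s_0,\rho_0,\phi_0)$ to $\Gamma$ is $$\operatorname{dist}(p_0,\Gamma)=\frac1{t\sqrt2}\,\rho_0^2(r_0^2+1)\,\mathcal F\!\left(\tfrac12,\tfrac14,\tfrac32,-\frac{\rho_0^4(r_0^2+1)^2}{t^4}\right),$$ where $\mathcal F(\alpha,\beta,\gamma,\cdot)$ is the hypergeometric function, that is, the (existing and unique) analytic continuation to $\mathbb C\setminus[1,\infty)$ of the series $1+\frac{\alpha\beta}{\gamma\cdot1}z+\frac{\alpha(\alpha+1)\beta(\beta+1)}{\gamma(\gamma+1)\cdot1\cdot2}z^2+\cdots$, $|z|<1$. -/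

import Mathlib

open scoped Manifold ContDiff ENNReal

noncomputable section

namespace EguchiHanson

/-! ### The complex surface `H² = T*ℙ¹(ℂ)` -/

/-- Homogeneous coordinates `(α, β, γ)` with `(α, β) ≠ 0`. -/
abbrev Triple : Type := {v : ℂ × ℂ // v ≠ 0} × ℂ

/-- `(α, β, γ) ∼ (A α, A β, γ / A²)` for `A ∈ ℂ*`. -/
instance tripleSetoid : Setoid Triple where
  r x y := ∃ A : ℂ, A ≠ 0 ∧ y.1.1.1 = A * x.1.1.1 ∧ y.1.1.2 = A * x.1.1.2 ∧ y.2 = x.2 / A ^ 2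
  iseqv := by
    refine ⟨fun x => ⟨1, by simp⟩, ?_, ?_⟩
    · rintro x y ⟨A, hA, h1, h2, h3⟩
      refine ⟨A⁻¹, inv_ne_zero hA, ?_, ?_, ?_⟩
      · rw [h1]; field_simp
      · rw [h2]; field_simp
      · rw [h3]; field_simp
    · rintro x y z ⟨A, hA, h1, h2, h3⟩ ⟨B, hB, k1, k2, k3⟩
      refine ⟨B * A, mul_ne_zero hB hA, ?_, ?_, ?_⟩
      · rw [k1, h1]; ring
      · rw [k2, h2]; ring
      · rw [k3, h3]; field_simp

/-- The total space `H² = T*ℙ¹(ℂ)`, with the quotient topology. -/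
def H2 : Type := Quotient tripleSetoid

instance : TopologicalSpace H2 := inferInstanceAs (TopologicalSpace (Quotient tripleSetoid))

/-- The class `[α, β, γ]`. -/
def mk (α β γ : ℂ) (h : (α, β) ≠ (0 : ℂ × ℂ)) : H2 := Quotient.mk tripleSetoid (⟨(α, β), h⟩, γ)

/-- The quotient map. -/
def toH2 (v : Triple) : H2 := Quotient.mk tripleSetoid v

theorem isQuotientMap_toH2 : Topology.IsQuotientMap toH2 :=
  isQuotientMap_quot_mk

/-- The open set where `β ≠ 0`. -/
def Ubeta : Set H2 :=
  {x | Quotient.liftOn x (fun v : Triple => v.1.1.2 ≠ 0) (by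
    rintro v w ⟨A, hA, h1, h2, h3⟩
    simp [h2, hA])}

/-- The open set where `α ≠ 0`. -/
def Ualpha : Set H2 :=
  {x | Quotient.liftOn x (fun v : Triple => v.1.1.1 ≠ 0) (by
    rintro v w ⟨A, hA, h1, h2, h3⟩
    simp [h1, hA])}

/-- The coordinates `[α, β, γ] ↦ (α / β, γ β²)` on `Ubeta`. -/
def coordBeta (x : H2) : ℂ × ℂ :=
  Quotient.liftOn x (fun v : Triple => (v.1.1.1 / v.1.1.2, v.2 * v.1.1.2 ^ 2)) (by
    rintro v w ⟨A, hA, h1, h2, h3⟩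
    simp only [h1, h2, h3, Prod.mk.injEq]
    constructor
    · rw [mul_div_mul_left _ _ hA]
    · field_simp)

/-- The coordinates `[α, β, γ] ↦ (β / α, γ α²)` on `Ualpha`. -/
def coordAlpha (x : H2) : ℂ × ℂ :=
  Quotient.liftOn x (fun v : Triple => (v.1.1.2 / v.1.1.1, v.2 * v.1.1.1 ^ 2)) (by
    rintro v w ⟨A, hA, h1, h2, h3⟩
    simp only [h1, h2, h3, Prod.mk.injEq]
    constructor
    · rw [mul_div_mul_left _ _ hA]
    · field_simp)

theorem isOpen_Ubeta : IsOpen Ubeta := by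
  rw [← isQuotientMap_toH2.isOpen_preimage]
  exact isOpen_ne_fun (f := fun v : Triple => v.1.1.2) (g := fun _ => 0)
    (by fun_prop) continuous_const

theorem isOpen_Ualpha : IsOpen Ualpha := by
  rw [← isQuotientMap_toH2.isOpen_preimage]
  exact isOpen_ne_fun (f := fun v : Triple => v.1.1.1) (g := fun _ => 0)
    (by fun_prop) continuous_const

/-- The chart of `H²` on `Ubeta`; its inverse is `(w, c) ↦ [w, 1, c]`. -/
def chartBeta : OpenPartialHomeomorph H2 (ℂ × ℂ) where
  toFun := coordBeta
  invFun z := mk z.1 1 z.2 (by simp)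
  source := Ubeta
  target := Set.univ
  map_source' _ _ := Set.mem_univ _
  map_target' z _ := show (1 : ℂ) ≠ 0 from one_ne_zero
  left_inv' := by
    intro x hx
    induction x using Quotient.inductionOn with
    | h v =>
      have hv : v.1.1.2 ≠ 0 := hx
      refine Quotient.sound ⟨v.1.1.2, hv, ?_, ?_, ?_⟩
      · simp only [coordBeta, Quotient.liftOn_mk]; field_simp
      · simp
      · simp only [coordBeta, Quotient.liftOn_mk]; field_simp
  right_inv' z _ := by simp [coordBeta, mk]
  open_source := isOpen_Ubeta
  open_target := isOpen_univ
  continuousOn_toFun := by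
    rw [isQuotientMap_toH2.continuousOn_isOpen_iff isOpen_Ubeta]
    refine ContinuousOn.prodMk (ContinuousOn.div (by fun_prop) (by fun_prop) ?_) (by fun_prop)
    exact fun v hv => hv
  continuousOn_invFun := by
    refine Continuous.continuousOn ?_
    refine isQuotientMap_toH2.continuous.comp ?_
    exact Continuous.prodMk (Continuous.subtype_mk (by fun_prop) _) (by fun_prop)

/-- The chart of `H²` on `Ualpha`; its inverse is `(w, c) ↦ [1, w, c]`. -/
def chartAlpha : OpenPartialHomeomorph H2 (ℂ × ℂ) where
  toFun := coordAlpha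
  invFun z := mk 1 z.1 z.2 (by simp)
  source := Ualpha
  target := Set.univ
  map_source' _ _ := Set.mem_univ _
  map_target' z _ := show (1 : ℂ) ≠ 0 from one_ne_zero
  left_inv' := by
    intro x hx
    induction x using Quotient.inductionOn with
    | h v =>
      have hv : v.1.1.1 ≠ 0 := hx
      refine Quotient.sound ⟨v.1.1.1, hv, ?_, ?_, ?_⟩
      · simp
      · simp only [coordAlpha, Quotient.liftOn_mk]; field_simp
      · simp only [coordAlpha, Quotient.liftOn_mk]; field_simp
  right_inv' z _ := by simp [coordAlpha, mk]
  open_source := isOpen_Ualpha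
  open_target := isOpen_univ
  continuousOn_toFun := by
    rw [isQuotientMap_toH2.continuousOn_isOpen_iff isOpen_Ualpha]
    refine ContinuousOn.prodMk (ContinuousOn.div (by fun_prop) (by fun_prop) ?_) (by fun_prop)
    exact fun v hv => hv
  continuousOn_invFun := by
    refine Continuous.continuousOn ?_
    refine isQuotientMap_toH2.continuous.comp ?_
    exact Continuous.prodMk (Continuous.subtype_mk (by fun_prop) _) (by fun_prop)

open Classical in
instance : ChartedSpace (ℂ × ℂ) H2 where
  atlas := {chartBeta, chartAlpha}
  chartAt x := if x ∈ Ubeta then chartBeta else chartAlpha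
  mem_chart_source x := by
    split_ifs with h
    · exact h
    · induction x using Quotient.inductionOn with
      | h v =>
        have hv : v.1.1.2 = 0 := not_not.mp h
        intro h1
        exact v.1.2 (Prod.ext h1 hv)
  chart_mem_atlas x := by split_ifs <;> simp

theorem chartAt_of_mem_Ubeta {x : H2} (hx : x ∈ Ubeta) : chartAt (ℂ × ℂ) x = chartBeta :=
  if_pos hx

theorem chartAt_of_notMem_Ubeta {x : H2} (hx : x ∉ Ubeta) : chartAt (ℂ × ℂ) x = chartAlpha :=
  if_neg hx

/-- `H²` is a complex surface. -/
instance : IsManifold 𝓘(ℂ, ℂ × ℂ) ω H2 := by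
  have key : ContDiffOn ℂ ω (fun z : ℂ × ℂ => ((1 : ℂ) / z.1, z.2 * z.1 ^ 2)) {z | z.1 ≠ 0} :=
    ContDiffOn.prodMk (contDiffOn_const.div contDiffOn_fst fun z hz => hz) (by fun_prop)
  apply isManifold_of_contDiffOn
  rintro e e' (rfl | rfl) (rfl | rfl)
  · refine (contDiffOn_id (𝕜 := ℂ)).congr fun z _ => ?_
    exact chartBeta.right_inv (Set.mem_univ z)
  · exact (key.mono fun z hz => hz.1.2).congr fun z _ => rfl
  · exact (key.mono fun z hz => hz.1.2).congr fun z _ => rfl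
  · refine (contDiffOn_id (𝕜 := ℂ)).congr fun z _ => ?_
    exact chartAlpha.right_inv (Set.mem_univ z)

/-- The underlying smooth real four-manifold. -/
instance : IsManifold 𝓘(ℝ, ℂ × ℂ) ∞ H2 := by
  apply isManifold_of_contDiffOn
  intro e e' he he'
  have h := (contDiffGroupoid ω 𝓘(ℂ, ℂ × ℂ)).compatible he he'
  rw [contDiffGroupoid, mem_groupoid_of_pregroupoid] at h
  exact ((h.1 : ContDiffOn ℂ ω _ _).restrict_scalars ℝ).of_le le_top

/-- The zero section of `H²`: the points `[α, β, 0]`. -/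
def zeroSection : Set H2 :=
  {x | Quotient.liftOn x (fun v : Triple => v.2 = 0) (by
    rintro v w ⟨A, hA, h1, h2, h3⟩
    simp [h3, hA])}

/-! ### The Eguchi-Hanson metric -/

/-- The function `u₁([α, β, γ]) = (|α|² + |β|²) |γ|`. -/
def u1 (x : H2) : ℝ :=
  Quotient.liftOn x (fun v : Triple => (‖v.1.1.1‖ ^ 2 + ‖v.1.1.2‖ ^ 2) * ‖v.2‖) (by
    rintro v w ⟨A, hA, h1, h2, h3⟩
    have : ‖A‖ ≠ 0 := norm_ne_zero_iff.mpr hA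
    simp only [h1, h2, h3, norm_mul, norm_div, norm_pow]
    field_simp)

/-- The Kähler potential `f_t = √(u₁² + t⁴) + t² log (u₁ / (√(u₁² + t⁴) + t²))`, which is
meaningful off the zero section. -/
def kahlerPotential (t : ℝ) (x : H2) : ℝ :=
  √(u1 x ^ 2 + t ^ 4) + t ^ 2 * Real.log (u1 x / (√(u1 x ^ 2 + t ^ 4) + t ^ 2))

/-- The function `f_t - t² log |c|` in either of the two charts, `c` being the fibre coordinate
(see `kahlerPotential_chartBeta`, `kahlerPotential_chartAlpha`). In this form it extends smoothly
over the zero section `c = 0`. As `log |c|` is pluriharmonic for `c ≠ 0`, it has the same `i∂∂̄`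
as `f_t` there, so that its `i∂∂̄` is the smooth extension of `i∂∂̄ f_t` to all of `H²`. -/
def localPotential (t : ℝ) (z : ℂ × ℂ) : ℝ :=
  √((1 + ‖z.1‖ ^ 2) ^ 2 * ‖z.2‖ ^ 2 + t ^ 4) +
    t ^ 2 * Real.log ((1 + ‖z.1‖ ^ 2) /
      (√((1 + ‖z.1‖ ^ 2) ^ 2 * ‖z.2‖ ^ 2 + t ^ 4) + t ^ 2))

theorem localPotential_aux {t : ℝ} (ht : 0 < t) {a c : ℝ} (ha : 0 < a) (hc : 0 < c) :
    √((a * c) ^ 2 + t ^ 4) + t ^ 2 * Real.log (a * c / (√((a * c) ^ 2 + t ^ 4) + t ^ 2)) =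
      √(a ^ 2 * c ^ 2 + t ^ 4) + t ^ 2 * Real.log (a / (√(a ^ 2 * c ^ 2 + t ^ 4) + t ^ 2)) +
        t ^ 2 * Real.log c := by
  rw [mul_pow]
  have h : 0 < √(a ^ 2 * c ^ 2 + t ^ 4) + t ^ 2 := by positivity
  rw [Real.log_div (by positivity) h.ne', Real.log_div ha.ne' h.ne',
    Real.log_mul ha.ne' hc.ne']
  ring

theorem kahlerPotential_chartBeta {t : ℝ} (ht : 0 < t) (z : ℂ × ℂ) (hz : z.2 ≠ 0) :
    kahlerPotential t (chartBeta.symm z) = localPotential t z + t ^ 2 * Real.log ‖z.2‖ := by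
  have hu : u1 (chartBeta.symm z) = (1 + ‖z.1‖ ^ 2) * ‖z.2‖ := by
    change (‖z.1‖ ^ 2 + ‖(1 : ℂ)‖ ^ 2) * ‖z.2‖ = _
    rw [norm_one]; ring
  rw [kahlerPotential, hu, localPotential]
  exact localPotential_aux ht (by positivity) (norm_pos_iff.mpr hz)

theorem kahlerPotential_chartAlpha {t : ℝ} (ht : 0 < t) (z : ℂ × ℂ) (hz : z.2 ≠ 0) :
    kahlerPotential t (chartAlpha.symm z) = localPotential t z + t ^ 2 * Real.log ‖z.2‖ := by
  have hu : u1 (chartAlpha.symm z) = (1 + ‖z.1‖ ^ 2) * ‖z.2‖ := by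
    change (‖(1 : ℂ)‖ ^ 2 + ‖z.1‖ ^ 2) * ‖z.2‖ = _
    rw [norm_one]; ring
  rw [kahlerPotential, hu, localPotential]
  exact localPotential_aux ht (by positivity) (norm_pos_iff.mpr hz)

/-- The second derivative `D²F(z)(X, Y)` of a real function on `ℂ²`. -/
def hess (F : ℂ × ℂ → ℝ) (z X Y : ℂ × ℂ) : ℝ := fderiv ℝ (fderiv ℝ F) z X Y

/-- The real two-form `i∂∂̄F` on `ℂ²`. Writing `F_{jk̄} = ∂²F/∂z_j∂z̄_k`, it is
`i ∑ F_{jk̄} dz_j ∧ dz̄_k`, and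
`D²F(X, Y) = 2 Re ∑ F_{jk̄} X_j Ȳ_k + 2 Re ∑ F_{jk} X_j Y_k` gives the expression below. -/
def iddbar (F : ℂ × ℂ → ℝ) (z X Y : ℂ × ℂ) : ℝ :=
  (hess F z (Complex.I • X) Y - hess F z X (Complex.I • Y)) / 2

theorem contDiff_localPotential {t : ℝ} (ht : 0 < t) : ContDiff ℝ ∞ (localPotential t) := by
  have h1 : ContDiff ℝ ∞ (fun z : ℂ × ℂ => ‖z.1‖ ^ 2) := contDiff_fst.norm_sq ℝ
  have h2 : ContDiff ℝ ∞ (fun z : ℂ × ℂ => ‖z.2‖ ^ 2) := contDiff_snd.norm_sq ℝ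
  have h3 : ContDiff ℝ ∞ (fun z : ℂ × ℂ => (1 : ℝ) + ‖z.1‖ ^ 2) := contDiff_const.add h1
  have h4 : ContDiff ℝ ∞
      (fun z : ℂ × ℂ => √((1 + ‖z.1‖ ^ 2) ^ 2 * ‖z.2‖ ^ 2 + t ^ 4)) :=
    (((h3.pow 2).mul h2).add contDiff_const).sqrt fun z => by positivity
  refine h4.add (contDiff_const.mul (ContDiff.log (h3.div (h4.add contDiff_const) ?_) ?_))
  · intro z; positivity
  · intro z; positivity

theorem hasFDerivAt_log_norm_snd {z : ℂ × ℂ} (hz : z.2 ≠ 0) :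
    HasFDerivAt (fun y : ℂ × ℂ => Real.log ‖y.2‖)
      (Complex.reCLM ∘L (z.2⁻¹ • ContinuousLinearMap.snd ℝ ℂ ℂ)) z := by
  have h0 : ‖z.2‖ ≠ 0 := norm_ne_zero_iff.mpr hz
  have h1 : HasFDerivAt (fun y : ℂ × ℂ => ‖y.2‖ ^ 2) _ z :=
    (hasFDerivAt_snd (𝕜 := ℝ) (p := z)).norm_sq
  have h2 := (h1.log (pow_ne_zero 2 h0)).const_mul (1 / 2)
  have h3 : (fun y : ℂ × ℂ => Real.log ‖y.2‖) = fun y => 1 / 2 * Real.log (‖y.2‖ ^ 2) := by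
    funext y; rw [Real.log_pow]; push_cast; ring
  rw [h3]
  refine h2.congr_fderiv ?_
  ext Y
  · simp
  · simp
    rw [← Complex.normSq_eq_norm_sq]
    have : Complex.normSq z.2 ≠ 0 := Complex.normSq_eq_zero.not.mpr hz
    field_simp
    ring

/-- The function `log |c|` does not contribute to `i∂∂̄` for `c ≠ 0`. With
`kahlerPotential_chartBeta` and `kahlerPotential_chartAlpha` this gives
`i∂∂̄ f_t = i∂∂̄ (localPotential t)` off the zero section. -/
theorem iddbar_add_log {F : ℂ × ℂ → ℝ} (hF : ContDiff ℝ ∞ F) (k : ℝ) {z : ℂ × ℂ} (hz : z.2 ≠ 0)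
    (X Y : ℂ × ℂ) :
    iddbar (fun y => F y + k * Real.log ‖y.2‖) z X Y = iddbar F z X Y := by
  have hd : Differentiable ℝ F := hF.differentiable (by simp)
  have hd2 : Differentiable ℝ (fderiv ℝ F) :=
    (hF.fderiv_right (m := 1) (by norm_cast)).differentiable (by simp)
  let L : ℂ →L[ℝ] (ℂ × ℂ →L[ℝ] ℝ) :=
    (ContinuousLinearMap.compL ℝ (ℂ × ℂ) ℂ ℝ Complex.reCLM) ∘L
      ((ContinuousLinearMap.lsmul ℝ ℂ (E := ℂ × ℂ →L[ℝ] ℂ)).flip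
        (ContinuousLinearMap.snd ℝ ℂ ℂ))
  have hL : ∀ c Y, L c Y = (c * Y.2).re := fun c Y => rfl
  have hopen : {y : ℂ × ℂ | y.2 ≠ 0} ∈ nhds z :=
    (isOpen_ne_fun continuous_snd continuous_const).mem_nhds hz
  have h1 : fderiv ℝ (fun y => F y + k * Real.log ‖y.2‖) =ᶠ[nhds z]
      fun y => fderiv ℝ F y + k • L y.2⁻¹ := by
    filter_upwards [hopen] with y hy
    exact ((hd y).hasFDerivAt.add ((hasFDerivAt_log_norm_snd hy).const_mul k)).fderiv
  have hinv : HasFDerivAt (fun y : ℂ × ℂ => y.2⁻¹)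
      ((-(z.2 ^ 2)⁻¹) • ContinuousLinearMap.snd ℝ ℂ ℂ) z := by
    have h := ((hasDerivAt_inv hz).hasFDerivAt.restrictScalars ℝ).comp z
      (hasFDerivAt_snd (𝕜 := ℝ) (p := z))
    refine h.congr_fderiv ?_
    ext Y <;> simp [mul_comm]
  have h2 : fderiv ℝ (fderiv ℝ (fun y => F y + k * Real.log ‖y.2‖)) z =
      fderiv ℝ (fderiv ℝ F) z +
        k • (L ∘L ((-(z.2 ^ 2)⁻¹) • ContinuousLinearMap.snd ℝ ℂ ℂ)) := by
    rw [h1.fderiv_eq]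
    exact ((hd2 z).hasFDerivAt.add ((L.hasFDerivAt.comp z hinv).const_smul k)).fderiv
  have h3 : ∀ X Y, hess (fun y => F y + k * Real.log ‖y.2‖) z X Y =
      hess F z X Y + k * ((-(z.2 ^ 2)⁻¹) * X.2 * Y.2).re := by
    intro X Y
    rw [hess, h2]
    rfl
  have h4 : (-(z.2 ^ 2)⁻¹) * (Complex.I • X).2 * Y.2 =
      (-(z.2 ^ 2)⁻¹) * X.2 * (Complex.I • Y).2 := by
    simp only [Prod.smul_snd, smul_eq_mul]; ring
  rw [iddbar, iddbar, h3, h3, h4]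
  ring

/-- The Kähler form `ω_t = i∂∂̄ f_t` on `T_x H²`; tangent vectors are written in the preferred
chart at `x`. -/
def kahlerForm (t : ℝ) (x : H2) (X Y : TangentSpace 𝓘(ℝ, ℂ × ℂ) x) : ℝ :=
  iddbar (localPotential t) (chartAt (ℂ × ℂ) x x) (X : ℂ × ℂ) (Y : ℂ × ℂ)

/-- Off the zero section, `ω_t` is `i∂∂̄` of the function `f_t`. -/
theorem kahlerForm_eq {t : ℝ} (ht : 0 < t) {x : H2} (hx : x ∉ zeroSection)
    (X Y : TangentSpace 𝓘(ℝ, ℂ × ℂ) x) :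
    kahlerForm t x X Y =
      iddbar (fun z => kahlerPotential t ((chartAt (ℂ × ℂ) x).symm z))
        (chartAt (ℂ × ℂ) x x) (X : ℂ × ℂ) (Y : ℂ × ℂ) := by
  have hloc : ∀ f : ℂ × ℂ → ℝ, ∀ z : ℂ × ℂ, z.2 ≠ 0 → ∀ U V : ℂ × ℂ,
      (∀ y : ℂ × ℂ, y.2 ≠ 0 → f y = localPotential t y + t ^ 2 * Real.log ‖y.2‖) →
      iddbar f z U V = iddbar (localPotential t) z U V := by
    intro f z hz U V hf
    rw [← iddbar_add_log (contDiff_localPotential ht) (t ^ 2) hz]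
    have : f =ᶠ[nhds z] fun y => localPotential t y + t ^ 2 * Real.log ‖y.2‖ := by
      filter_upwards [(isOpen_ne_fun continuous_snd continuous_const).mem_nhds hz] with y hy
      exact hf y hy
    simp only [iddbar, hess, this.fderiv.fderiv_eq]
  symm
  by_cases h : x ∈ Ubeta
  · rw [kahlerForm, chartAt_of_mem_Ubeta h]
    refine hloc _ _ ?_ _ _ (kahlerPotential_chartBeta ht)
    induction x using Quotient.inductionOn with
    | h v => exact mul_ne_zero hx (pow_ne_zero 2 h)
  · rw [kahlerForm, chartAt_of_notMem_Ubeta h]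
    refine hloc _ _ ?_ _ _ (kahlerPotential_chartAlpha ht)
    have h' : x ∈ Ualpha := by
      have := mem_chart_source (ℂ × ℂ) x
      rwa [chartAt_of_notMem_Ubeta h] at this
    induction x using Quotient.inductionOn with
    | h v => exact mul_ne_zero hx (pow_ne_zero 2 h')

/-- The complex structure `J` on `T_x H²`. -/
def complexStructure (x : H2) (X : TangentSpace 𝓘(ℝ, ℂ × ℂ) x) : TangentSpace 𝓘(ℝ, ℂ × ℂ) x :=
  show ℂ × ℂ from Complex.I • (show ℂ × ℂ from X)

/-- The Eguchi-Hanson metric `g_t(X, Y) = ω_t(X, JY)`. -/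
def metric (t : ℝ) (x : H2) (X Y : TangentSpace 𝓘(ℝ, ℂ × ℂ) x) : ℝ :=
  kahlerForm t x X (complexStructure x Y)

/-! ### Hypersurfaces over curves, and their inner distance -/

/-- The projection `H² → ℙ¹(ℂ) = ℂ ∪ {∞}`, `[α, β, γ] ↦ α / β`. -/
def proj (x : H2) : OnePoint ℂ :=
  open Classical in
  Quotient.liftOn x
    (fun v : Triple => if v.1.1.2 = 0 then OnePoint.infty else ((v.1.1.1 / v.1.1.2 : ℂ) : OnePoint ℂ))
    (by
      rintro v w ⟨A, hA, h1, h2, h3⟩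
      simp [h1, h2, hA, mul_div_mul_left])

/-- The preimage `M³_C = p⁻¹(C)` of a curve `C ⊆ ℂ ⊆ ℙ¹(ℂ)`. -/
def hypersurface (C : Set ℂ) : Set H2 := proj ⁻¹' ((fun w : ℂ => (w : OnePoint ℂ)) '' C)

/-- The length of a curve `c : [0, 1] → H²` with respect to `g_t`. -/
def pathLength (t : ℝ) (c : ℝ → H2) : ℝ≥0∞ :=
  ∫⁻ τ in Set.Icc (0 : ℝ) 1, ENNReal.ofReal √(metric t (c τ)
    (mfderiv 𝓘(ℝ, ℝ) 𝓘(ℝ, ℂ × ℂ) c τ (1 : ℝ)) (mfderiv 𝓘(ℝ, ℝ) 𝓘(ℝ, ℂ × ℂ) c τ (1 : ℝ)))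

/-- The Riemannian distance in an embedded submanifold `S` of `H²` with the metric induced by
`g_t`: the infimum of the lengths of the `C¹` curves from `p` to `q` inside `S`. -/
def innerEDist (t : ℝ) (S : Set H2) (p q : H2) : ℝ≥0∞ :=
  ⨅ (c : ℝ → H2) (_ : ContMDiffOn 𝓘(ℝ, ℝ) 𝓘(ℝ, ℂ × ℂ) 1 c (Set.Icc 0 1))
    (_ : Set.MapsTo c (Set.Icc 0 1) S) (_ : c 0 = p) (_ : c 1 = q), pathLength t c

/-- The distance from `p` to the set `A` for the inner distance of `S`. -/
def innerInfEDist (t : ℝ) (S : Set H2) (p : H2) (A : Set H2) : ℝ≥0∞ :=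
  ⨅ q ∈ A, innerEDist t S p q

/-- The parametrization `Ψ(s, ρ, φ)` of `M³_Γ` outside of the zero section: the point
`[Γ(s), 1, γ]` with `√γ = ρ e^{iφ}`. -/
def Psi (Γ : ℝ → ℂ) (s ρ φ : ℝ) : H2 :=
  mk (Γ s) 1 ((ρ * Complex.exp (φ * Complex.I)) ^ 2) (by simp)

/-! ### The hypergeometric function -/

/-- `F` is the hypergeometric function with parameters `a, b, c` on the slit plane `ℂ ∖ [1, ∞)`: it
is the analytic continuation of the hypergeometric series in the unit disc. -/
def IsHypergeometric (a b c : ℂ) (F : ℂ → ℂ) : Prop :=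
  AnalyticOnNhd ℂ F {z : ℂ | z.im ≠ 0 ∨ z.re < 1} ∧
    ∀ z : ℂ, ‖z‖ < 1 → F z = ordinaryHypergeometric a b c z

end EguchiHanson

end

noncomputable section

namespace EguchiHanson

/-! ### The metric in coordinates -/

/-! In the chart `(w, c)` put `a = 1 + |w|²`, so that `u₁ = a|c|`, and `S = √(u₁² + t⁴)`. Computing
the Hessian of `localPotential` shows that the squared length of `X = (X₁, X₂)` is `|Q|²/(2S) +
2S|X₁|²/a²` with `Q = a X₂ + 2 c w̄ X₁` (`hess_add_hess_I_smul`). The same `Q` governs the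
differential of `u₁`: for `c ≠ 0`, `du₁(X) = Re(c̄ Q)/|c|`, hence `|du₁(X)| ≤ |Q| ≤ √(2S) |X|`.

Consequently `fibreDist t u₁`, where `fibreDist` is the primitive of `1/√(2√(v² + t⁴))` vanishing at
`0`, is 1-Lipschitz along curves and vanishes on the zero section. This bounds the distance from
below (`fibreDist_le_integral_speed`). Shrinking `c` radially to `0` with `w` fixed turns every
inequality into an equality (`integral_speed_ray`). This ray stays in one fibre, hence in the
hypersurface over any set containing `w`, so the distance is exactly `fibreDist t u₁`
(`innerInfEDist_zeroSection`).

Rescaling that integral to `[0, 1]` gives `u/(t√2) · ∫ (1 + u²τ²/t⁴)^(-1/4) dτ`, which is Euler's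
integral for the hypergeometric function at `-u²/t⁴`. The Euler integral is analytic on the slit
plane and agrees with the series in the unit disc. It is therefore a continuation, and the identity
theorem makes it the only one. At the given point `u = (1 + r₀²) ρ₀²`. -/

/-- The second derivative along a line is the Hessian evaluated on the direction of the line. -/
theorem hess_self_eq_of_hasDerivAt {F : ℂ × ℂ → ℝ} (hF : ContDiff ℝ ∞ F) {z X : ℂ × ℂ}
    {f' : ℝ → ℝ} {f'' : ℝ} (h1 : ∀ s : ℝ, HasDerivAt (fun s : ℝ => F (z + s • X)) (f' s) s)
    (h2 : HasDerivAt f' f'' 0) : hess F z X X = f'' := by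
  have hd : Differentiable ℝ F := hF.differentiable (by simp)
  have hd2 : Differentiable ℝ (fderiv ℝ F) :=
    (hF.fderiv_right (m := 1) (by norm_cast)).differentiable (by simp)
  have hline : ∀ s : ℝ, HasDerivAt (fun s : ℝ => z + s • X) X s := fun s => by
    simpa using ((hasDerivAt_id s).smul_const X).const_add z
  -- Uniqueness of derivatives identifies the given `f'` with `DF` along the line, so `f''` must be
  -- the derivative of the latter.
  have e : f' = fun s : ℝ => fderiv ℝ F (z + s • X) X := by
    funext s
    exact (h1 s).unique ((hd _).hasFDerivAt.comp_hasDerivAt s (hline s))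
  have h3 : HasDerivAt (fun s : ℝ => fderiv ℝ F (z + s • X))
      (fderiv ℝ (fderiv ℝ F) z X) 0 := by
    have := (hd2 (z + (0 : ℝ) • X)).hasFDerivAt.comp_hasDerivAt (0 : ℝ) (hline 0)
    rw [zero_smul, add_zero] at this
    exact this
  have h4 : HasDerivAt (fun s : ℝ => fderiv ℝ F (z + s • X) X)
      (fderiv ℝ (fderiv ℝ F) z X X) 0 := by
    simpa using h3.clm_apply (hasDerivAt_const (0 : ℝ) X)
  exact h4.unique (e ▸ h2)

/-- With `S = √(A²B + t⁴)`, the terms containing `S'` combine to `S' - t² S'/(S + t²) = S S'/(S +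
t²)`, and `S S' = (A²B)'/2`. So `S'` disappears, and the second differentiation stays short. -/
theorem hasDerivAt_potential {t : ℝ} (ht : 0 < t) {A B : ℝ → ℝ} {A' B' s : ℝ}
    (hA : HasDerivAt A A' s) (hB : HasDerivAt B B' s) (hA0 : 0 < A s) (hB0 : 0 ≤ B s) :
    HasDerivAt (fun s => √(A s ^ 2 * B s + t ^ 4) +
        t ^ 2 * Real.log (A s / (√(A s ^ 2 * B s + t ^ 4) + t ^ 2)))
      ((2 * A s * A' * B s + A s ^ 2 * B') / (2 * (√(A s ^ 2 * B s + t ^ 4) + t ^ 2))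
        + t ^ 2 * (A' / A s)) s := by
  have hq : 0 < A s ^ 2 * B s + t ^ 4 := by positivity
  have hS := (((hA.pow 2).mul hB).add_const (t ^ 4)).sqrt hq.ne'
  have hSp : 0 < √(A s ^ 2 * B s + t ^ 4) := Real.sqrt_pos.mpr hq
  have hSp' : √((A ^ 2 * B) s + t ^ 4) + t ^ 2 ≠ 0 := by
    simp only [Pi.mul_apply, Pi.pow_apply]; positivity
  have h := hS.add (((hA.div (hS.add_const (t ^ 2)) hSp').log
    (div_ne_zero hA0.ne' hSp')).const_mul (t ^ 2))
  refine h.congr_deriv ?_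
  simp only [Pi.mul_apply, Pi.pow_apply, Pi.div_apply]
  field_simp
  ring

theorem hasDerivAt_potential' {t : ℝ} (ht : 0 < t) {A B A₁ B₁ : ℝ → ℝ} {A₂ B₂ s : ℝ}
    (hA : HasDerivAt A (A₁ s) s) (hB : HasDerivAt B (B₁ s) s)
    (hA₁ : HasDerivAt A₁ A₂ s) (hB₁ : HasDerivAt B₁ B₂ s) (hA0 : 0 < A s) (hB0 : 0 ≤ B s) :
    HasDerivAt (fun s => (2 * A s * A₁ s * B s + A s ^ 2 * B₁ s) /
          (2 * (√(A s ^ 2 * B s + t ^ 4) + t ^ 2)) + t ^ 2 * (A₁ s / A s))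
      ((2 * A₁ s ^ 2 * B s + 2 * A s * A₂ * B s + 4 * A s * A₁ s * B₁ s + A s ^ 2 * B₂) /
          (2 * (√(A s ^ 2 * B s + t ^ 4) + t ^ 2))
        - (2 * A s * A₁ s * B s + A s ^ 2 * B₁ s) ^ 2 /
          (4 * √(A s ^ 2 * B s + t ^ 4) * (√(A s ^ 2 * B s + t ^ 4) + t ^ 2) ^ 2)
        + t ^ 2 * (A₂ / A s - A₁ s ^ 2 / A s ^ 2)) s := by
  have hq : 0 < A s ^ 2 * B s + t ^ 4 := by positivity
  have hS := (((hA.pow 2).mul hB).add_const (t ^ 4)).sqrt hq.ne'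
  have hSp : 0 < √(A s ^ 2 * B s + t ^ 4) := Real.sqrt_pos.mpr hq
  have h := ((((hA.const_mul 2).mul hA₁).mul hB).add ((hA.pow 2).mul hB₁)).div
    ((hS.add_const (t ^ 2)).const_mul 2) (by positivity)
  have h' := h.add ((hA₁.div hA hA0.ne').const_mul (t ^ 2))
  refine h'.congr_deriv ?_
  simp only [Pi.mul_apply, Pi.pow_apply, Pi.add_apply]
  field_simp
  ring

/-- The squared norm of the tangent vector `X` at the point with coordinates `(w, c)`. -/
def coordNormSq (t : ℝ) (z X : ℂ × ℂ) : ℝ :=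
  ‖(1 + ‖z.1‖ ^ 2 : ℝ) * X.2 + 2 * z.2 * starRingEnd ℂ z.1 * X.1‖ ^ 2 /
      (2 * √((1 + ‖z.1‖ ^ 2) ^ 2 * ‖z.2‖ ^ 2 + t ^ 4)) +
    2 * √((1 + ‖z.1‖ ^ 2) ^ 2 * ‖z.2‖ ^ 2 + t ^ 4) * ‖X.1‖ ^ 2 / (1 + ‖z.1‖ ^ 2) ^ 2

theorem norm_add_smul_sq (w v : ℂ) (s : ℝ) :
    ‖w + s • v‖ ^ 2 = ‖w‖ ^ 2 + 2 * (w.re * v.re + w.im * v.im) * s + ‖v‖ ^ 2 * s ^ 2 := by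
  simp only [Complex.sq_norm, Complex.normSq_apply, Complex.add_re, Complex.add_im,
    Complex.real_smul, Complex.mul_re, Complex.mul_im, Complex.ofReal_re, Complex.ofReal_im]
  ring

/-- Along the line `z + sX`, the potential depends on `s` only through `A = 1 + |z₁ + sX₁|²` and `B
= |z₂ + sX₂|²`. Both are quadratic in `s`, with first derivatives `a'`, `b'` at `s = 0`. -/
theorem hess_localPotential_self {t : ℝ} (ht : 0 < t) (z X : ℂ × ℂ) {a b S a' b' : ℝ}
    (ha : a = 1 + ‖z.1‖ ^ 2) (hb : b = ‖z.2‖ ^ 2) (hS : S = √(a ^ 2 * b + t ^ 4))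
    (ha' : a' = 2 * (z.1.re * X.1.re + z.1.im * X.1.im))
    (hb' : b' = 2 * (z.2.re * X.2.re + z.2.im * X.2.im)) :
    hess (localPotential t) z X X =
      (2 * a' ^ 2 * b + 2 * a * (2 * ‖X.1‖ ^ 2) * b + 4 * a * a' * b' + a ^ 2 * (2 * ‖X.2‖ ^ 2)) /
          (2 * (S + t ^ 2))
        - (2 * a * a' * b + a ^ 2 * b') ^ 2 / (4 * S * (S + t ^ 2) ^ 2)
        + t ^ 2 * (2 * ‖X.1‖ ^ 2 / a - a' ^ 2 / a ^ 2) := by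
  set A : ℝ → ℝ := fun s => 1 + ‖z.1 + s • X.1‖ ^ 2 with hA
  set B : ℝ → ℝ := fun s => ‖z.2 + s • X.2‖ ^ 2 with hB
  have dA : ∀ s, HasDerivAt A (a' + ‖X.1‖ ^ 2 * (2 * s)) s := fun s => by
    have h := ((((hasDerivAt_id s).const_mul a').const_add (‖z.1‖ ^ 2)).add
      (((hasDerivAt_id s).pow 2).const_mul (‖X.1‖ ^ 2))).const_add 1
    refine (h.congr_deriv (by simp)).congr_of_eventuallyEq (.of_forall fun s => ?_)
    simp only [hA, norm_add_smul_sq, ha']; simp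
  have dB : ∀ s, HasDerivAt B (b' + ‖X.2‖ ^ 2 * (2 * s)) s := fun s => by
    have h := (((hasDerivAt_id s).const_mul b').const_add (‖z.2‖ ^ 2)).add
      (((hasDerivAt_id s).pow 2).const_mul (‖X.2‖ ^ 2))
    refine (h.congr_deriv (by simp)).congr_of_eventuallyEq (.of_forall fun s => ?_)
    simp only [hB, norm_add_smul_sq, hb']; simp
  have hlin : ∀ k l : ℝ, HasDerivAt (fun s : ℝ => k + l * (2 * s)) (2 * l) 0 := fun k l => by
    have := (((hasDerivAt_id (0 : ℝ)).const_mul 2).const_mul l).const_add k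
    exact this.congr_deriv (by simp [mul_comm])
  have pA : ∀ s, 0 < A s := fun s => by simp only [hA]; positivity
  have pB : ∀ s, 0 ≤ B s := fun s => by simp only [hB]; positivity
  have A0 : A 0 = a := by simp [hA, ha]
  have B0 : B 0 = b := by simp [hB, hb]
  have key := hasDerivAt_potential' ht (dA 0) (dB 0) (hlin a' _) (hlin b' _)
    (pA 0) (pB 0)
  rw [hess_self_eq_of_hasDerivAt (contDiff_localPotential ht)
    (fun s => hasDerivAt_potential ht (dA s) (dB s)
      (pA s) (pB s)) key]
  simp only [A0, B0, mul_zero, add_zero, hS]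

/-- The left side is `i∂∂̄` of the potential on `(X, iX)`. Averaging over `X` and `iX` turns squares
of real parts into squared moduli, which assemble into the modulus `|a X₂ + 2 c w̄ X₁|²`. -/
theorem hess_add_hess_I_smul {t : ℝ} (ht : 0 < t) (z X : ℂ × ℂ) :
    (hess (localPotential t) z (Complex.I • X) (Complex.I • X) +
      hess (localPotential t) z X X) / 2 = coordNormSq t z X := by
  rw [hess_localPotential_self ht z X rfl rfl rfl rfl rfl,
    hess_localPotential_self ht z (Complex.I • X) rfl rfl rfl rfl rfl, coordNormSq]
  have hq : 0 < (1 + ‖z.1‖ ^ 2) ^ 2 * ‖z.2‖ ^ 2 + t ^ 4 := by positivity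
  have hS : 0 < √((1 + ‖z.1‖ ^ 2) ^ 2 * ‖z.2‖ ^ 2 + t ^ 4) := Real.sqrt_pos.mpr hq
  have hS2 := Real.sq_sqrt hq.le
  set S := √((1 + ‖z.1‖ ^ 2) ^ 2 * ‖z.2‖ ^ 2 + t ^ 4)
  have ha : 0 < 1 + ‖z.1‖ ^ 2 := by positivity
  have n1 : ‖(Complex.I • X).1‖ = ‖X.1‖ := by simp
  have n2 : ‖(Complex.I • X).2‖ = ‖X.2‖ := by simp
  rw [n1, n2]
  clear_value S
  generalize haa : 1 + ‖z.1‖ ^ 2 = a at *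
  have e1 : ‖(a : ℂ) * X.2 + 2 * z.2 * starRingEnd ℂ z.1 * X.1‖ ^ 2 =
      a ^ 2 * ‖X.2‖ ^ 2 + 4 * a * ((z.1.re * X.1.re + z.1.im * X.1.im) *
        (z.2.re * X.2.re + z.2.im * X.2.im) + (z.1.re * X.1.im - z.1.im * X.1.re) *
        (z.2.re * X.2.im - z.2.im * X.2.re)) + 4 * ‖z.2‖ ^ 2 * (a - 1) * ‖X.1‖ ^ 2 := by
    rw [← haa, add_sub_cancel_left]
    simp only [Complex.sq_norm, Complex.normSq_apply]
    simp
    ring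
  -- Here and in `e3`: `|w|²|v|² = (Re w̄v)² + (Im w̄v)²`.
  have e2 : (a - 1) * ‖X.1‖ ^ 2 = (z.1.re * X.1.re + z.1.im * X.1.im) ^ 2 +
      (z.1.re * X.1.im - z.1.im * X.1.re) ^ 2 := by
    rw [← haa, add_sub_cancel_left]
    simp only [Complex.sq_norm, Complex.normSq_apply]
    ring
  have e3 : ‖z.2‖ ^ 2 * ‖X.2‖ ^ 2 = (z.2.re * X.2.re + z.2.im * X.2.im) ^ 2 +
      (z.2.re * X.2.im - z.2.im * X.2.re) ^ 2 := by
    simp only [Complex.sq_norm, Complex.normSq_apply]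
    ring
  -- Multiplication of `v` by `i` sends `Re(w̄v)` to `-Im(w̄v)`.
  have i1 : z.1.re * (Complex.I • X).1.re + z.1.im * (Complex.I • X).1.im =
      - (z.1.re * X.1.im - z.1.im * X.1.re) := by simp; ring
  have i2 : z.2.re * (Complex.I • X).2.re + z.2.im * (Complex.I • X).2.im =
      - (z.2.re * X.2.im - z.2.im * X.2.re) := by simp; ring
  rw [e1, i1, i2]
  generalize z.1.re * X.1.re + z.1.im * X.1.im = p at *
  generalize z.1.re * X.1.im - z.1.im * X.1.re = p' at *
  generalize z.2.re * X.2.re + z.2.im * X.2.im = r at *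
  generalize z.2.re * X.2.im - z.2.im * X.2.re = r' at *
  generalize ‖X.1‖ ^ 2 = W at *
  generalize ‖X.2‖ ^ 2 = C at *
  generalize ‖z.2‖ ^ 2 = b at *
  have N1 : (2 * (2 * -p') ^ 2 * b + 2 * a * (2 * W) * b + 4 * a * (2 * -p') * (2 * -r') +
        a ^ 2 * (2 * C)) + (2 * (2 * p) ^ 2 * b + 2 * a * (2 * W) * b + 4 * a * (2 * p) * (2 * r) +
        a ^ 2 * (2 * C)) =
      4 * (a ^ 2 * C + 4 * a * (p * r + p' * r') + 4 * b * (a - 1) * W) + 8 * b * W := by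
    linear_combination (-8 * b) * e2
  have N2 : (2 * a * (2 * -p') * b + a ^ 2 * (2 * -r')) ^ 2 +
        (2 * a * (2 * p) * b + a ^ 2 * (2 * r)) ^ 2 =
      4 * (a ^ 2 * b) * (a ^ 2 * C + 4 * a * (p * r + p' * r') + 4 * b * (a - 1) * W) := by
    linear_combination (-16 * a ^ 2 * b ^ 2) * e2 - 4 * a ^ 4 * e3
  have N3 : (2 * W / a - (2 * -p') ^ 2 / a ^ 2) + (2 * W / a - (2 * p) ^ 2 / a ^ 2) =
      4 * W / a ^ 2 := by
    field_simp
    linear_combination 4 * e2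
  generalize a ^ 2 * C + 4 * a * (p * r + p' * r') + 4 * b * (a - 1) * W = Q at *
  -- Since `a²b = (S - t²)(S + t²)`, a factor `S + t²` cancels: the coefficient of `Q` collapses to
  -- `1/(2S)`, that of `W` to `2S/a²`.
  have hb : b = (S ^ 2 - t ^ 4) / a ^ 2 := by field_simp; linarith
  have hSt : 0 < S + t ^ 2 := by positivity
  calc _ = ((2 * (2 * -p') ^ 2 * b + 2 * a * (2 * W) * b + 4 * a * (2 * -p') * (2 * -r') +
        a ^ 2 * (2 * C)) + (2 * (2 * p) ^ 2 * b + 2 * a * (2 * W) * b + 4 * a * (2 * p) * (2 * r) +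
        a ^ 2 * (2 * C))) / (4 * (S + t ^ 2)) -
        ((2 * a * (2 * -p') * b + a ^ 2 * (2 * -r')) ^ 2 +
        (2 * a * (2 * p) * b + a ^ 2 * (2 * r)) ^ 2) / (8 * S * (S + t ^ 2) ^ 2) +
        t ^ 2 / 2 * ((2 * W / a - (2 * -p') ^ 2 / a ^ 2) + (2 * W / a - (2 * p) ^ 2 / a ^ 2)) := by
        field_simp
        ring
    _ = (4 * Q + 8 * b * W) / (4 * (S + t ^ 2)) -
        (4 * (a ^ 2 * b) * Q) / (8 * S * (S + t ^ 2) ^ 2) + t ^ 2 / 2 * (4 * W / a ^ 2) := by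
        rw [N1, N2, N3]
    _ = _ := by
        rw [hb]
        field_simp
        ring

theorem metric_self_of_mem_Ubeta {t : ℝ} (ht : 0 < t) {x : H2} (hx : x ∈ Ubeta) (X : ℂ × ℂ) :
    metric t x X X = coordNormSq t (coordBeta x) X := by
  have h0 : chartAt (ℂ × ℂ) x x = coordBeta x := by rw [chartAt_of_mem_Ubeta hx]; rfl
  have h1 : metric t x X X = iddbar (localPotential t) (coordBeta x) X (Complex.I • X) := by
    rw [← h0]; rfl
  have h2 : Complex.I • Complex.I • X = -X := by
    rw [smul_smul, Complex.I_mul_I, neg_one_smul]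
  rw [h1, iddbar, h2, ← hess_add_hess_I_smul ht]
  simp only [hess, map_neg]
  ring

/-! ### The hypergeometric function with parameters `1/2, 1/4, 3/2` -/

/-- Euler's integral for the hypergeometric function with parameters `1/2, 1/4, 3/2`. -/
def eulerIntegral (z : ℂ) : ℂ := ∫ τ in (0 : ℝ)..1, (1 - z * (τ : ℂ) ^ 2) ^ (-(1 / 4) : ℂ)

theorem one_sub_mul_sq_mem_slitPlane {z : ℂ} (hz : z.im ≠ 0 ∨ z.re < 1) {τ : ℝ}
    (h0 : 0 ≤ τ) (h1 : τ ≤ 1) : 1 - z * (τ : ℂ) ^ 2 ∈ Complex.slitPlane := by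
  have hτ : τ ^ 2 ≤ 1 := pow_le_one₀ h0 h1
  have hre : (1 - z * (τ : ℂ) ^ 2).re = 1 - z.re * τ ^ 2 := by
    simp [← Complex.ofReal_pow]
  have him : (1 - z * (τ : ℂ) ^ 2).im = -(z.im * τ ^ 2) := by
    simp [← Complex.ofReal_pow]
  rw [Complex.mem_slitPlane_iff, hre, him]
  rcases h0.eq_or_lt with rfl | h0
  · simp
  rcases hz with hz | hz
  · right
    exact neg_ne_zero.mpr (mul_ne_zero hz (by positivity))
  · left
    have : 0 < τ ^ 2 := by positivity
    nlinarith

theorem isOpen_slit : IsOpen {z : ℂ | z.im ≠ 0 ∨ z.re < 1} :=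
  (isOpen_ne_fun Complex.continuous_im continuous_const).union
    (isOpen_lt Complex.continuous_re continuous_const)

theorem isPreconnected_slit : IsPreconnected {z : ℂ | z.im ≠ 0 ∨ z.re < 1} := by
  have : StarConvex ℝ 0 {z : ℂ | z.im ≠ 0 ∨ z.re < 1} := by
    rw [starConvex_zero_iff]
    rintro z hz a h0 h1
    rcases h0.eq_or_lt with rfl | h0
    · simp
    rcases hz with hz | hz
    · left
      simpa using ⟨h0.ne', hz⟩
    · right
      have : (a • z).re = a * z.re := by simp
      rw [this]
      nlinarith
  exact (this.isPathConnected (Or.inr (by simp))).isConnected.isPreconnected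

/-- Complex differentiability on an open set suffices. Differentiation under the integral is
justified by a uniform bound on the compact set (closed ball) × `[0, 1]`, where the base of the
power stays in the slit plane. -/
theorem analyticOnNhd_eulerIntegral :
    AnalyticOnNhd ℂ eulerIntegral {z : ℂ | z.im ≠ 0 ∨ z.re < 1} := by
  refine DifferentiableOn.analyticOnNhd (fun z₀ hz₀ => ?_) isOpen_slit
  refine DifferentiableAt.differentiableWithinAt ?_
  obtain ⟨ε, hε, hball⟩ := Metric.nhds_basis_closedBall.mem_iff.mp (isOpen_slit.mem_nhds hz₀)
  set K : Set (ℂ × ℝ) := Metric.closedBall z₀ ε ×ˢ Set.Icc 0 1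
  have hK : IsCompact K := (isCompact_closedBall z₀ ε).prod isCompact_Icc
  have hslit : ∀ p ∈ K, 1 - p.1 * (p.2 : ℂ) ^ 2 ∈ Complex.slitPlane := fun p hp =>
    one_sub_mul_sq_mem_slitPlane (hball hp.1) hp.2.1 hp.2.2
  have hcont : ∀ e : ℂ, ContinuousOn (fun p : ℂ × ℝ => (1 - p.1 * (p.2 : ℂ) ^ 2) ^ e) K := fun e =>
    ContinuousOn.cpow_const (by fun_prop) hslit
  have hcont1 : ContinuousOn (fun p : ℂ × ℝ =>
      -(1 / 4) * (1 - p.1 * (p.2 : ℂ) ^ 2) ^ (-(1 / 4) - 1 : ℂ) * -(p.2 : ℂ) ^ 2) K :=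
    (continuousOn_const.mul (hcont _)).mul (by fun_prop)
  obtain ⟨C, hC⟩ := hK.exists_bound_of_continuousOn hcont1
  have hsec : ∀ z ∈ Metric.closedBall z₀ ε,
      Set.MapsTo (fun τ : ℝ => (z, τ)) (Set.uIcc 0 1) K := fun z hz τ hτ =>
    ⟨hz, by rwa [Set.uIcc_of_le zero_le_one] at hτ⟩
  have hint : ∀ z ∈ Metric.closedBall z₀ ε, ∀ {f : ℂ × ℝ → ℂ}, ContinuousOn f K →
      IntervalIntegrable (fun τ => f (z, τ)) MeasureTheory.volume 0 1 := fun z hz f hf =>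
    (hf.comp (by fun_prop) (hsec z hz)).intervalIntegrable
  have hz₀' : z₀ ∈ Metric.closedBall z₀ ε := Metric.mem_closedBall_self hε.le
  refine (intervalIntegral.hasDerivAt_integral_of_dominated_loc_of_deriv_le
    (F := fun z τ => (1 - z * (τ : ℂ) ^ 2) ^ (-(1 / 4) : ℂ))
    (F' := fun z τ => -(1 / 4) * (1 - z * (τ : ℂ) ^ 2) ^ (-(1 / 4) - 1 : ℂ) * -(τ : ℂ) ^ 2)
    (bound := fun _ => C) (Metric.closedBall_mem_nhds z₀ hε) ?_ (hint z₀ hz₀' (hcont _)) ?_ ?_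
    intervalIntegrable_const ?_).2.differentiableAt
  · filter_upwards [Metric.closedBall_mem_nhds z₀ hε] with z hz
    exact (hint z hz (hcont (-(1 / 4)))).def'.aestronglyMeasurable
  · exact (hint z₀ hz₀' hcont1).def'.aestronglyMeasurable
  · refine .of_forall fun τ hτ z hz => hC (z, τ) (hsec z hz (Set.uIoc_subset_uIcc hτ))
  · refine .of_forall fun τ hτ z hz => ?_
    have h := (((hasDerivAt_id z).mul_const ((τ : ℂ) ^ 2)).const_sub 1).cpow_const
      (c := -(1 / 4)) (hslit (z, τ) (hsec z hz (Set.uIoc_subset_uIcc hτ)))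
    exact h.congr_deriv (by simp)

/-- Binomial series, with the coefficient `Ring.choose (a + n - 1) n` rewritten as the rising
factorial of `a` over `n!` to match the hypergeometric series. -/
theorem hasSum_one_sub_cpow (a : ℂ) {y : ℂ} (hy : ‖y‖ < 1) :
    HasSum (fun n : ℕ => ((n.factorial : ℂ)⁻¹ * (ascPochhammer ℂ n).eval a) * y ^ n)
      ((1 - y) ^ (-a)) := by
  have h := (Complex.one_div_one_sub_cpow_hasFPowerSeriesOnBall_zero a).hasSum
    (y := y) (by
      rw [Metric.mem_eball, edist_zero_right, ← ofReal_norm, ENNReal.ofReal_lt_one]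
      exact hy)
  simp only [zero_add, one_div, ← Complex.cpow_neg] at h
  suffices hfun : (fun n : ℕ => ((n.factorial : ℂ)⁻¹ * (ascPochhammer ℂ n).eval a) * y ^ n) =
      fun n => FormalMultilinearSeries.ofScalars ℂ (fun n : ℕ => Ring.choose (a + n - 1) n) n
        fun _ => y by
    rw [hfun]
    exact h
  funext n
  have e : Ring.choose (a + n - 1) n = Ring.multichoose a n := by
    rw [Ring.choose]
    congr 1
    ring
  have e' := Ring.factorial_nsmul_multichoose_eq_ascPochhammer a n
  rw [Polynomial.ascPochhammer_smeval_cast, Polynomial.ascPochhammer_smeval_eq_eval,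
    nsmul_eq_mul] at e'
  have : (n.factorial : ℂ) ≠ 0 := by exact_mod_cast n.factorial_ne_zero
  rw [FormalMultilinearSeries.ofScalars_apply_eq, e, ← e', smul_eq_mul, inv_mul_cancel_left₀ this]

/-- The product telescopes, because shifting `1/2` by one gives `3/2`. The value is `∫₀¹ τ^(2n) dτ`,
which is why Euler's integral has no further weight. -/
theorem eval_ascPochhammer_half (n : ℕ) :
    (ascPochhammer ℂ n).eval (1 / 2) * ((ascPochhammer ℂ n).eval (3 / 2))⁻¹ =
      1 / (2 * n + 1) := by
  have h1 : (ascPochhammer ℂ (n + 1)).eval (1 / 2) = 1 / 2 * (ascPochhammer ℂ n).eval (3 / 2) := by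
    rw [ascPochhammer_succ_left]
    simp
    norm_num
  rw [ascPochhammer_succ_eval] at h1
  have h2 : (ascPochhammer ℂ n).eval (3 / 2 : ℂ) ≠ 0 := by
    rw [Ne, ascPochhammer_eval_eq_zero_iff]
    rintro ⟨k, -, hk⟩
    have := congrArg Complex.re hk
    norm_num at this
    have := k.cast_nonneg (α := ℝ)
    linarith
  have h3 : (2 * n + 1 : ℂ) ≠ 0 := by norm_cast
  field_simp
  linear_combination 2 * h1

theorem summable_norm_coeff (a : ℂ) {r : ℝ} (h0 : 0 ≤ r) (h1 : r < 1) :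
    Summable fun n : ℕ => ‖(n.factorial : ℂ)⁻¹ * (ascPochhammer ℂ n).eval a‖ * r ^ n := by
  have h : ‖(r : ℂ)‖ < 1 := by simpa [abs_of_nonneg h0] using h1
  have := (hasSum_one_sub_cpow a h).summable.norm
  simpa [abs_of_nonneg h0] using this

/-- Expand the integrand by the binomial series and integrate term by term; the series at `‖z‖ < 1`
dominates uniformly in `τ`. -/
theorem eulerIntegral_eq_ordinaryHypergeometric {z : ℂ} (hz : ‖z‖ < 1) :
    eulerIntegral z = ordinaryHypergeometric (1 / 2 : ℂ) (1 / 4 : ℂ) (3 / 2 : ℂ) z := by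
  have h := intervalIntegral.hasSum_integral_of_dominated_convergence (a := 0) (b := 1)
    (μ := MeasureTheory.volume)
    (F := fun (n : ℕ) (τ : ℝ) => ((n.factorial : ℂ)⁻¹ * (ascPochhammer ℂ n).eval (1 / 4)) *
      (z * (τ : ℂ) ^ 2) ^ n) (f := fun τ : ℝ => (1 - z * (τ : ℂ) ^ 2) ^ (-(1 / 4) : ℂ))
    (fun n _ => ‖(n.factorial : ℂ)⁻¹ * (ascPochhammer ℂ n).eval (1 / 4)‖ * ‖z‖ ^ n)
    (fun n => Continuous.aestronglyMeasurable (by fun_prop))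
    (fun n => .of_forall fun τ hτ => ?_)
    (.of_forall fun τ _ => summable_norm_coeff _ (norm_nonneg z) hz)
    intervalIntegrable_const (.of_forall fun τ hτ => hasSum_one_sub_cpow _ ?_)
  · rw [eulerIntegral, ← h.tsum_eq, ordinaryHypergeometric_eq_tsum]
    refine tsum_congr fun n => ?_
    have : ∀ τ : ℝ, ((n.factorial : ℂ)⁻¹ * (ascPochhammer ℂ n).eval (1 / 4)) *
        (z * (τ : ℂ) ^ 2) ^ n = ((n.factorial : ℂ)⁻¹ * (ascPochhammer ℂ n).eval (1 / 4)) *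
        z ^ n * ((τ ^ (2 * n) : ℝ) : ℂ) := fun τ => by push_cast; ring
    simp only [this]
    rw [intervalIntegral.integral_const_mul, intervalIntegral.integral_ofReal, integral_pow]
    have e := eval_ascPochhammer_half n
    rw [smul_eq_mul]
    push_cast
    rw [one_pow, zero_pow (by omega), sub_zero, ← e]
    ring
  all_goals
    have h01 : ‖(τ : ℂ) ^ 2‖ ≤ 1 := by
      rw [Set.uIoc_of_le zero_le_one] at hτ
      rw [norm_pow, Complex.norm_real, Real.norm_of_nonneg hτ.1.le]
      exact pow_le_one₀ hτ.1.le hτ.2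
  · rw [norm_mul, norm_pow, norm_mul]
    gcongr
    rw [norm_mul]
    exact mul_le_of_le_one_right (norm_nonneg z) h01
  · rw [norm_mul]
    exact (mul_le_of_le_one_right (norm_nonneg z) h01).trans_lt hz

theorem isHypergeometric_eulerIntegral : IsHypergeometric (1 / 2) (1 / 4) (3 / 2) eulerIntegral :=
  ⟨analyticOnNhd_eulerIntegral, fun _ hz => eulerIntegral_eq_ordinaryHypergeometric hz⟩

/-- The analytic continuation of the hypergeometric series to the slit plane is unique. -/
theorem IsHypergeometric.eqOn {a b c : ℂ} {F G : ℂ → ℂ} (hF : IsHypergeometric a b c F)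
    (hG : IsHypergeometric a b c G) : Set.EqOn F G {z : ℂ | z.im ≠ 0 ∨ z.re < 1} := by
  refine hF.1.eqOn_of_preconnected_of_eventuallyEq hG.1 isPreconnected_slit (z₀ := 0) (by simp) ?_
  filter_upwards [Metric.ball_mem_nhds (0 : ℂ) one_pos] with z hz
  have hz' : ‖z‖ < 1 := by simpa using hz
  rw [hF.2 z hz', hG.2 z hz']

theorem eulerIntegral_neg_ofReal {x : ℝ} (hx : 0 ≤ x) :
    eulerIntegral (-(x : ℂ)) = (∫ τ in (0 : ℝ)..1, (1 + x * τ ^ 2) ^ (-(1 / 4) : ℝ) : ℝ) := by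
  rw [eulerIntegral, ← intervalIntegral.integral_ofReal]
  congr 1
  funext τ
  rw [Complex.ofReal_cpow (by positivity)]
  push_cast
  ring_nf

/-! ### Lengths of curves in the chart `Ubeta` -/

/-- Tangent vectors are read in the preferred chart at the point, which is `chartBeta` throughout
`Ubeta`. A single coordinate curve thus serves for all times. -/
theorem mfderiv_eq_deriv_coordBeta {c : ℝ → H2} {τ : ℝ}
    (h : MDifferentiableAt 𝓘(ℝ, ℝ) 𝓘(ℝ, ℂ × ℂ) c τ) (hU : c τ ∈ Ubeta) :
    mfderiv 𝓘(ℝ, ℝ) 𝓘(ℝ, ℂ × ℂ) c τ (1 : ℝ) = deriv (coordBeta ∘ c) τ := by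
  refine (DFunLike.congr_fun h.mfderiv (1 : ℝ)).trans ?_
  change fderivWithin ℝ (chartAt (ℂ × ℂ) (c τ) ∘ c) (Set.range id) τ 1 = _
  rw [chartAt_of_mem_Ubeta hU, Set.range_id, fderivWithin_univ, fderiv_apply_one_eq_deriv]
  rfl

theorem contDiffOn_coordBeta_comp {c : ℝ → H2} {s : Set ℝ}
    (h : ContMDiffOn 𝓘(ℝ, ℝ) 𝓘(ℝ, ℂ × ℂ) 1 c s) (hU : Set.MapsTo c s Ubeta) :
    ContDiffOn ℝ 1 (coordBeta ∘ c) s := by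
  -- An arbitrary point of `Ubeta`, serving only to exhibit `chartBeta` as a preferred chart.
  have h0 : (mk 0 1 0 (by simp) : H2) ∈ Ubeta := show (1 : ℂ) ≠ 0 from one_ne_zero
  have h1 := contMDiffOn_chart (I := 𝓘(ℝ, ℂ × ℂ)) (n := ∞) (x := (mk 0 1 0 (by simp) : H2))
  rw [chartAt_of_mem_Ubeta h0] at h1
  exact ((h1.of_le (by norm_cast)).comp h hU).contDiffOn

theorem contMDiff_chartBeta_symm {z : ℝ → ℂ × ℂ} (h : ContDiff ℝ 1 z) :
    ContMDiff 𝓘(ℝ, ℝ) 𝓘(ℝ, ℂ × ℂ) 1 (fun τ => chartBeta.symm (z τ)) := by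
  have h0 : (mk 0 1 0 (by simp) : H2) ∈ Ubeta := show (1 : ℂ) ≠ 0 from one_ne_zero
  have h1 := contMDiffOn_chart_symm (I := 𝓘(ℝ, ℂ × ℂ)) (n := ∞) (x := (mk 0 1 0 (by simp) : H2))
  rw [chartAt_of_mem_Ubeta h0] at h1
  exact (contMDiffOn_univ.mp (h1.of_le (by norm_cast))).comp h.contMDiff

theorem continuousOn_coordNormSq {t : ℝ} (ht : 0 < t) {z X : ℝ → ℂ × ℂ} {s : Set ℝ}
    (hz : ContinuousOn z s) (hX : ContinuousOn X s) :
    ContinuousOn (fun τ => coordNormSq t (z τ) (X τ)) s := by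
  have : Continuous fun p : (ℂ × ℂ) × (ℂ × ℂ) => coordNormSq t p.1 p.2 := by
    unfold coordNormSq
    have hpow : Continuous fun p : (ℂ × ℂ) × (ℂ × ℂ) => 1 + ‖p.1.1‖ ^ 2 := by fun_prop
    have hsqrt : Continuous fun p : (ℂ × ℂ) × (ℂ × ℂ) =>
        2 * √((1 + ‖p.1.1‖ ^ 2) ^ 2 * ‖p.1.2‖ ^ 2 + t ^ 4) := by fun_prop
    have hconj : Continuous fun p : (ℂ × ℂ) × (ℂ × ℂ) => starRingEnd ℂ p.1.1 :=
      Complex.continuous_conj.comp (by fun_prop)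
    have hnum : Continuous fun p : (ℂ × ℂ) × (ℂ × ℂ) => ‖((1 + ‖p.1.1‖ ^ 2 : ℝ) : ℂ) * p.2.2 +
        2 * p.1.2 * starRingEnd ℂ p.1.1 * p.2.1‖ ^ 2 :=
      ((((Complex.continuous_ofReal.comp hpow).mul (by fun_prop)).add
        ((Continuous.mul (by fun_prop) hconj).mul (by fun_prop))).norm).pow 2
    have hpos : ∀ p : (ℂ × ℂ) × (ℂ × ℂ),
        0 < (1 + ‖p.1.1‖ ^ 2) ^ 2 * ‖p.1.2‖ ^ 2 + t ^ 4 := fun p => by positivity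
    exact (hnum.div hsqrt fun p => (mul_pos two_pos (Real.sqrt_pos.mpr (hpos p))).ne').add
      ((hsqrt.mul (by fun_prop)).div (hpow.pow 2) fun p => by positivity)
  exact this.comp_continuousOn (f := fun τ => (z τ, X τ)) (hz.prodMk hX)

/-- The speed of a curve in the coordinates on `Ubeta`. -/
def speed (t : ℝ) (z : ℝ → ℂ × ℂ) (τ : ℝ) : ℝ :=
  √(coordNormSq t (z τ) (derivWithin z (Set.Icc 0 1) τ))

theorem continuousOn_speed {t : ℝ} (ht : 0 < t) {z : ℝ → ℂ × ℂ}
    (hz : ContDiffOn ℝ 1 z (Set.Icc 0 1)) : ContinuousOn (speed t z) (Set.Icc 0 1) :=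
  (continuousOn_coordNormSq ht hz.continuousOn
    (hz.continuousOn_derivWithin (uniqueDiffOn_Icc zero_lt_one) le_rfl)).sqrt

theorem pathLength_eq_integral_speed {t : ℝ} (ht : 0 < t) {c : ℝ → H2}
    (h : ContMDiffOn 𝓘(ℝ, ℝ) 𝓘(ℝ, ℂ × ℂ) 1 c (Set.Icc 0 1))
    (hU : Set.MapsTo c (Set.Icc 0 1) Ubeta) :
    pathLength t c = ENNReal.ofReal (∫ τ in (0 : ℝ)..1, speed t (coordBeta ∘ c) τ) := by
  have hs := continuousOn_speed ht (contDiffOn_coordBeta_comp h hU)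
  rw [intervalIntegral.integral_of_le zero_le_one, ← MeasureTheory.integral_Icc_eq_integral_Ioc,
    MeasureTheory.ofReal_integral_eq_lintegral_ofReal hs.integrableOn_Icc
      (.of_forall fun τ => Real.sqrt_nonneg _), pathLength,
    -- The two-sided derivative need not exist at the endpoints, where the curve is only one-sidedly
    -- smooth; they are discarded as a null set.
    ← MeasureTheory.setLIntegral_congr MeasureTheory.Ioo_ae_eq_Icc,
    ← MeasureTheory.setLIntegral_congr MeasureTheory.Ioo_ae_eq_Icc]
  refine MeasureTheory.setLIntegral_congr_fun measurableSet_Ioo fun τ hτ => ?_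
  have hn : Set.Icc (0 : ℝ) 1 ∈ nhds τ := Icc_mem_nhds hτ.1 hτ.2
  have hm : τ ∈ Set.Icc (0 : ℝ) 1 := Set.Ioo_subset_Icc_self hτ
  have hd := (h.contMDiffAt hn).mdifferentiableAt (by simp)
  simp only [mfderiv_eq_deriv_coordBeta hd (hU hm), speed, derivWithin_of_mem_nhds hn]
  rw [metric_self_of_mem_Ubeta ht (hU hm)]
  rfl

/-! ### The distance function -/

/-- The length of the ray from the zero section to a point with `u₁ = u` in a fibre. -/
def fibreDist (t u : ℝ) : ℝ := ∫ v in (0 : ℝ)..u, (√(2 * √(v ^ 2 + t ^ 4)))⁻¹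

theorem hasDerivAt_fibreDist {t : ℝ} (ht : 0 < t) (u : ℝ) :
    HasDerivAt (fibreDist t) (√(2 * √(u ^ 2 + t ^ 4)))⁻¹ u := by
  have hc : Continuous fun v : ℝ => (√(2 * √(v ^ 2 + t ^ 4)))⁻¹ :=
    Continuous.inv₀ (by fun_prop) fun v => by positivity
  exact intervalIntegral.integral_hasDerivAt_right (hc.intervalIntegrable _ _)
    (hc.stronglyMeasurableAtFilter _ _) hc.continuousAt

theorem fibreDist_nonneg (t : ℝ) {u : ℝ} (hu : 0 ≤ u) : 0 ≤ fibreDist t u :=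
  intervalIntegral.integral_nonneg hu fun v _ => by positivity

/-- Substitute `v = uτ` and pull `t⁴` out of the nested roots. -/
theorem fibreDist_eq {t : ℝ} (ht : 0 < t) (u : ℝ) :
    fibreDist t u = 1 / (t * √2) * u *
      ∫ τ in (0 : ℝ)..1, (1 + u ^ 2 / t ^ 4 * τ ^ 2) ^ (-(1 / 4) : ℝ) := by
  have h := intervalIntegral.smul_integral_comp_mul_left (a := 0) (b := 1)
    (fun v : ℝ => (√(2 * √(v ^ 2 + t ^ 4)))⁻¹) u
  rw [mul_zero, mul_one] at h
  rw [fibreDist, ← h, smul_eq_mul, mul_comm _ u, mul_assoc]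
  congr 1
  rw [← intervalIntegral.integral_const_mul]
  refine intervalIntegral.integral_congr fun τ _ => ?_
  have hy : 0 < 1 + u ^ 2 / t ^ 4 * τ ^ 2 := by positivity
  have e : (u * τ) ^ 2 + t ^ 4 = (t ^ 2) ^ 2 * (1 + u ^ 2 / t ^ 4 * τ ^ 2) := by
    field_simp
    ring
  rw [e, Real.sqrt_mul (by positivity) (1 + _), Real.sqrt_sq (by positivity),
    Real.sqrt_mul zero_le_two,
    Real.sqrt_mul (by positivity), Real.sqrt_sq ht.le, Real.rpow_neg hy.le,
    Real.sqrt_eq_rpow (√_), Real.sqrt_eq_rpow (1 + _), ← Real.rpow_mul hy.le]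
  norm_num
  ring

/-- The derivative is `Re(c̄ Q)/|c|` with `Q` the vector on the right, so its absolute value is at
most `|Q|`. The norm `|c|` is differentiable only off `c = 0`. -/
theorem exists_hasDerivAt_fibre_radius {z : ℝ → ℂ × ℂ} {X : ℂ × ℂ} {τ : ℝ} (h : HasDerivAt z X τ)
    (h0 : (z τ).2 ≠ 0) :
    ∃ d, HasDerivAt (fun τ => (1 + ‖(z τ).1‖ ^ 2) * ‖(z τ).2‖) d τ ∧
      |d| ≤ ‖(1 + ‖(z τ).1‖ ^ 2 : ℝ) * X.2 + 2 * (z τ).2 * starRingEnd ℂ (z τ).1 * X.1‖ := by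
  have hn : 0 < ‖(z τ).2‖ := norm_pos_iff.mpr h0
  have h1 := (hasFDerivAt_fst.comp_hasDerivAt τ h).norm_sq
  have h2 := (hasFDerivAt_snd.comp_hasDerivAt τ h).norm_sq.sqrt (pow_ne_zero 2 hn.ne')
  simp only [Function.comp_def, Real.sqrt_sq (norm_nonneg _), ContinuousLinearMap.coe_fst',
    ContinuousLinearMap.coe_snd', Complex.inner] at h1 h2
  refine ⟨_, (h1.const_add 1).mul h2, ?_⟩
  generalize z τ = y at *
  have key : 2 * (starRingEnd ℂ y.1 * X.1).re * ‖y.2‖ + (1 + ‖y.1‖ ^ 2) *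
      (2 * (starRingEnd ℂ y.2 * X.2).re / (2 * ‖y.2‖)) = (starRingEnd ℂ y.2 *
        ((1 + ‖y.1‖ ^ 2 : ℝ) * X.2 + 2 * y.2 * starRingEnd ℂ y.1 * X.1)).re / ‖y.2‖ := by
    have hsq := Complex.sq_norm y.2
    rw [Complex.normSq_apply] at hsq
    generalize 1 + ‖y.1‖ ^ 2 = a
    field_simp
    rw [hsq]
    simp
    ring
  rw [mul_comm (X.1), mul_comm (X.2)]
  rw [key, abs_div, abs_norm, div_le_iff₀ hn]
  refine (Complex.abs_re_le_norm _).trans ?_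
  rw [norm_mul, Complex.norm_conj, mul_comm]

/-- Only the nonnegative term `2S|X₁|²/a²` is dropped; equality holds for vectors tangent to the
fibres. -/
theorem div_sqrt_le_sqrt_coordNormSq (t : ℝ) (z X : ℂ × ℂ) :
    ‖(1 + ‖z.1‖ ^ 2 : ℝ) * X.2 + 2 * z.2 * starRingEnd ℂ z.1 * X.1‖ *
      (√(2 * √(((1 + ‖z.1‖ ^ 2) * ‖z.2‖) ^ 2 + t ^ 4)))⁻¹ ≤ √(coordNormSq t z X) := by
  refine Real.le_sqrt_of_sq_le ?_
  rw [mul_pow, inv_pow, Real.sq_sqrt (by positivity), coordNormSq, mul_pow, div_eq_mul_inv]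
  exact le_add_of_nonneg_right (by positivity)

theorem fibreDist_le_integral_speed {t : ℝ} (ht : 0 < t) {z : ℝ → ℂ × ℂ}
    (hz : ContDiffOn ℝ 1 z (Set.Icc 0 1)) (h1 : (z 1).2 = 0) :
    fibreDist t ((1 + ‖(z 0).1‖ ^ 2) * ‖(z 0).2‖) ≤ ∫ τ in (0 : ℝ)..1, speed t z τ := by
  have hzc := hz.continuousOn
  have hclosed : IsCompact (Set.Icc (0 : ℝ) 1 ∩ (fun τ => (z τ).2) ⁻¹' {0}) :=
    isCompact_Icc.of_isClosed_subset
      (hzc.snd.preimage_isClosed_of_isClosed isClosed_Icc isClosed_singleton) Set.inter_subset_left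
  -- `b` is the first time at which the curve meets the zero section. Before it the radius is
  -- differentiable; after it the speed is merely nonnegative.
  obtain ⟨b, hb⟩ := hclosed.exists_isLeast ⟨1, ⟨by simp, h1⟩⟩
  have hb01 : b ∈ Set.Icc (0 : ℝ) 1 := hb.1.1
  have hb0 : (z b).2 = 0 := hb.1.2
  have hsub : Set.Icc 0 b ⊆ Set.Icc (0 : ℝ) 1 := Set.Icc_subset_Icc_right hb01.2
  have hspeed := continuousOn_speed ht hz
  have hcont : ContinuousOn
      (fun τ => -fibreDist t ((1 + ‖(z τ).1‖ ^ 2) * ‖(z τ).2‖)) (Set.Icc 0 b) := by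
    have hF : Continuous (fibreDist t) :=
      continuous_iff_continuousAt.mpr fun u => (hasDerivAt_fibreDist ht u).continuousAt
    refine (hF.comp_continuousOn (ContinuousOn.mono ?_ hsub)).neg
    exact (continuousOn_const.add (hzc.fst.norm.pow 2)).mul hzc.snd.norm
  have hder : ∀ τ ∈ Set.Ioo 0 b, ∃ d, HasDerivAt
      (fun τ => -fibreDist t ((1 + ‖(z τ).1‖ ^ 2) * ‖(z τ).2‖)) d τ ∧ d ≤ speed t z τ := by
    intro τ hτ
    have hτ01 : τ ∈ Set.Icc (0 : ℝ) 1 := hsub (Set.Ioo_subset_Icc_self hτ)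
    have hn : Set.Icc (0 : ℝ) 1 ∈ nhds τ := Icc_mem_nhds hτ.1 (hτ.2.trans_le hb01.2)
    have hne : (z τ).2 ≠ 0 := fun h => (hb.2 ⟨hτ01, h⟩).not_gt hτ.2
    have hd : HasDerivAt z (derivWithin z (Set.Icc 0 1) τ) τ :=
      ((hz.differentiableOn one_ne_zero) τ hτ01).hasDerivWithinAt.hasDerivAt hn
    obtain ⟨d, hd1, hd2⟩ := exists_hasDerivAt_fibre_radius hd hne
    refine ⟨_, ((hasDerivAt_fibreDist ht _).comp τ hd1).neg, ?_⟩
    refine le_trans ?_ (div_sqrt_le_sqrt_coordNormSq t (z τ) _)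
    rw [neg_mul_eq_mul_neg, mul_comm]
    gcongr
    exact (neg_le_abs d).trans hd2
  choose! d hd hdle using hder
  -- This form of the mean value inequality needs only a pointwise bound on the derivative, whose
  -- integrability is not known.
  have key := intervalIntegral.sub_le_integral_of_hasDeriv_right_of_le hb01.1 hcont
    (fun τ hτ => (hd τ hτ).hasDerivWithinAt) (hspeed.mono hsub).integrableOn_Icc hdle
  have hmono : ∫ τ in (0 : ℝ)..b, speed t z τ ≤ ∫ τ in (0 : ℝ)..1, speed t z τ :=
    intervalIntegral.integral_mono_interval le_rfl hb01.1 hb01.2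
      (.of_forall fun τ => Real.sqrt_nonneg _)
      (hspeed.intervalIntegrable_of_Icc zero_le_one)
  have hF0 : fibreDist t 0 = 0 := intervalIntegral.integral_same
  simp only [hb0, norm_zero, mul_zero, hF0] at key
  linarith

/-- The velocity is `(0, -γ)`, so only the fibre term survives; the substitution `v = u(1 - τ)`
gives the result. -/
theorem integral_speed_ray (t : ℝ) (w γ : ℂ) :
    ∫ τ in (0 : ℝ)..1, speed t (fun τ : ℝ => (w, (1 - τ : ℝ) * γ)) τ =
      fibreDist t ((1 + ‖w‖ ^ 2) * ‖γ‖) := by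
  set u := (1 + ‖w‖ ^ 2) * ‖γ‖ with hu
  have hu0 : 0 ≤ u := by positivity
  have h := intervalIntegral.smul_integral_comp_mul_left (a := 0) (b := 1)
    (fun v : ℝ => (√(2 * √(v ^ 2 + t ^ 4)))⁻¹) u
  have h' := intervalIntegral.integral_comp_sub_left (a := 0) (b := 1)
    (fun v : ℝ => (√(2 * √((u * v) ^ 2 + t ^ 4)))⁻¹) 1
  rw [mul_zero, mul_one] at h
  rw [sub_zero, sub_self] at h'
  rw [fibreDist, ← h, ← h', smul_eq_mul, ← intervalIntegral.integral_const_mul]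
  refine intervalIntegral.integral_congr fun τ hτ => ?_
  rw [Set.uIcc_of_le zero_le_one] at hτ
  have hd : HasDerivAt (fun τ : ℝ => (w, ((1 - τ : ℝ) : ℂ) * γ)) (0, -γ) τ := by
    have h1 := (((hasDerivAt_id τ).const_sub 1).ofReal_comp).mul_const γ
    exact ((hasDerivAt_const τ w).prodMk h1).congr_deriv (by simp)
  have hdw := hd.hasDerivWithinAt.derivWithin (uniqueDiffOn_Icc (zero_lt_one (α := ℝ)) τ hτ)
  simp only [speed, hdw, coordNormSq]
  have e : (1 + ‖w‖ ^ 2) ^ 2 * ‖((1 - τ : ℝ) : ℂ) * γ‖ ^ 2 = (u * (1 - τ)) ^ 2 := by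
    rw [norm_mul, Complex.norm_real, mul_pow ‖_‖, Real.norm_eq_abs, sq_abs, hu]
    ring
  rw [e, mul_zero, add_zero, norm_zero, norm_mul, norm_neg, Complex.norm_real,
    Real.norm_of_nonneg (by positivity), ← hu]
  simp only [ne_eq, OfNat.ofNat_ne_zero, not_false_eq_true, zero_pow, mul_zero, zero_div, add_zero]
  rw [Real.sqrt_div' _ (by positivity), Real.sqrt_sq hu0, div_eq_mul_inv]

/-! ### Hypersurfaces over curves -/

/-- As `C` lies in `ℂ`, the point `∞` is avoided. Every competing curve therefore stays in one
chart. -/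
theorem hypersurface_subset_Ubeta (C : Set ℂ) : hypersurface C ⊆ Ubeta := by
  intro x hx
  induction x using Quotient.inductionOn with
  | h v =>
    intro hv
    obtain ⟨w, -, hw⟩ := hx
    change _ = if v.1.1.2 = 0 then OnePoint.infty else _ at hw
    rw [if_pos hv] at hw
    exact OnePoint.coe_ne_infty w hw

theorem chartBeta_symm_mem_hypersurface {C : Set ℂ} {z : ℂ × ℂ} (hz : z.1 ∈ C) :
    chartBeta.symm z ∈ hypersurface C := by
  refine ⟨z.1, hz, ?_⟩
  change _ = if (1 : ℂ) = 0 then OnePoint.infty else ((z.1 / 1 : ℂ) : OnePoint ℂ)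
  rw [if_neg one_ne_zero, div_one]

theorem coordBeta_snd_eq_zero {x : H2} (hx : x ∈ zeroSection) : (coordBeta x).2 = 0 := by
  induction x using Quotient.inductionOn with
  | h v =>
    have hv : v.2 = 0 := hx
    change v.2 * _ = 0
    rw [hv, zero_mul]

theorem coordBeta_chartBeta_symm (z : ℂ × ℂ) : coordBeta (chartBeta.symm z) = z :=
  chartBeta.right_inv (Set.mem_univ z)

theorem innerEDist_le_pathLength {t : ℝ} {S : Set H2} {p q : H2} {c : ℝ → H2}
    (hc : ContMDiffOn 𝓘(ℝ, ℝ) 𝓘(ℝ, ℂ × ℂ) 1 c (Set.Icc 0 1)) (hS : Set.MapsTo c (Set.Icc 0 1) S)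
    (h0 : c 0 = p) (h1 : c 1 = q) : innerEDist t S p q ≤ pathLength t c :=
  iInf_le_of_le c (iInf_le_of_le hc (iInf_le_of_le hS (iInf_le_of_le h0 (iInf_le _ h1))))

/-- The fibres of `p` realize the distance to the zero section, in the hypersurface over any set. -/
theorem innerInfEDist_zeroSection {t : ℝ} (ht : 0 < t) {C : Set ℂ} {z : ℂ × ℂ} (hz : z.1 ∈ C) :
    innerInfEDist t (hypersurface C) (chartBeta.symm z) (hypersurface C ∩ zeroSection) =
      ENNReal.ofReal (fibreDist t ((1 + ‖z.1‖ ^ 2) * ‖z.2‖)) := by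
  apply le_antisymm
  · have hray : ContDiff ℝ 1 fun τ : ℝ => (z.1, ((1 - τ : ℝ) : ℂ) * z.2) :=
      contDiff_const.prodMk
        ((Complex.ofRealCLM.contDiff.comp (contDiff_const.sub contDiff_id)).mul contDiff_const)
    have hc := (contMDiff_chartBeta_symm hray).contMDiffOn (s := Set.Icc 0 1)
    have hS : Set.MapsTo (fun τ : ℝ => chartBeta.symm (z.1, ((1 - τ : ℝ) : ℂ) * z.2))
      (Set.Icc 0 1) (hypersurface C) := fun τ _ => chartBeta_symm_mem_hypersurface hz
    have hq : chartBeta.symm (z.1, 0) ∈ hypersurface C ∩ zeroSection :=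
      ⟨chartBeta_symm_mem_hypersurface hz, show (0 : ℂ) = 0 from rfl⟩
    have h0 : chartBeta.symm (z.1, ((1 - (0 : ℝ) : ℝ) : ℂ) * z.2) = chartBeta.symm z := by simp
    have h1 : chartBeta.symm (z.1, ((1 - (1 : ℝ) : ℝ) : ℂ) * z.2) = chartBeta.symm (z.1, 0) := by
      simp
    refine (iInf₂_le _ hq).trans ((innerEDist_le_pathLength hc hS h0 h1).trans ?_)
    rw [pathLength_eq_integral_speed ht hc fun τ hτ => hypersurface_subset_Ubeta C (hS hτ),
      ← integral_speed_ray]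
    simp only [Function.comp_def, coordBeta_chartBeta_symm, le_refl]
  · refine le_iInf₂ fun q hq => le_iInf₂ fun c hc => le_iInf₂ fun hS h0 => le_iInf fun h1 => ?_
    have hU := hS.mono_right (hypersurface_subset_Ubeta C)
    rw [pathLength_eq_integral_speed ht hc hU]
    refine ENNReal.ofReal_le_ofReal ?_
    have h := fibreDist_le_integral_speed ht (contDiffOn_coordBeta_comp hc hU)
      (by rw [Function.comp_apply, h1]; exact coordBeta_snd_eq_zero hq.2)
    rwa [Function.comp_apply, h0, coordBeta_chartBeta_symm] at h

end EguchiHanson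

end

theorem proposition8p1 (t r₀ : ℝ) (ht : 0 < t) (hr₀ : 0 < r₀)
    (Γ : ℝ → ℂ) (hΓ : ContDiff ℝ 1 Γ) (hΓ_arc : ∀ s, ‖deriv Γ s‖ = 1) (hΓ_circle : ∀ s, ‖Γ s‖ = r₀) :
    (∃ F : ℂ → ℂ, EguchiHanson.IsHypergeometric (1 / 2) (1 / 4) (3 / 2) F) ∧
    ∀ F : ℂ → ℂ, EguchiHanson.IsHypergeometric (1 / 2) (1 / 4) (3 / 2) F →
      ∀ s₀ ρ₀ φ₀ : ℝ, 0 < ρ₀ →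
        EguchiHanson.innerInfEDist t (EguchiHanson.hypersurface (Set.range Γ))
          (EguchiHanson.Psi Γ s₀ ρ₀ φ₀)
          (EguchiHanson.hypersurface (Set.range Γ) ∩ EguchiHanson.zeroSection) ≠ ⊤ ∧
        ((EguchiHanson.innerInfEDist t (EguchiHanson.hypersurface (Set.range Γ))
          (EguchiHanson.Psi Γ s₀ ρ₀ φ₀)
          (EguchiHanson.hypersurface (Set.range Γ) ∩ EguchiHanson.zeroSection)).toReal : ℂ) =
          1 / (t * √2 : ℝ) * ρ₀ ^ 2 * (r₀ ^ 2 + 1) *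
            F (-(ρ₀ ^ 4 * (r₀ ^ 2 + 1) ^ 2 / t ^ 4)) := by
  refine ⟨⟨_, EguchiHanson.isHypergeometric_eulerIntegral⟩, fun F hF s₀ ρ₀ φ₀ hρ₀ => ?_⟩
  have hdist : EguchiHanson.innerInfEDist t (EguchiHanson.hypersurface (Set.range Γ))
      (EguchiHanson.Psi Γ s₀ ρ₀ φ₀)
      (EguchiHanson.hypersurface (Set.range Γ) ∩ EguchiHanson.zeroSection) =
      ENNReal.ofReal (EguchiHanson.fibreDist t ((1 + r₀ ^ 2) * ρ₀ ^ 2)) := by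
    have h := EguchiHanson.innerInfEDist_zeroSection ht (C := Set.range Γ)
      (z := (Γ s₀, (ρ₀ * Complex.exp (φ₀ * Complex.I)) ^ 2)) ⟨s₀, rfl⟩
    simp only [hΓ_circle, norm_pow, norm_mul, Complex.norm_exp_ofReal_mul_I, mul_one,
      Complex.norm_real, Real.norm_of_nonneg hρ₀.le] at h
    exact h
  rw [hdist, ENNReal.toReal_ofReal (EguchiHanson.fibreDist_nonneg t (by positivity))]
  refine ⟨ENNReal.ofReal_ne_top, ?_⟩
  have hx : (-(ρ₀ ^ 4 * (r₀ ^ 2 + 1) ^ 2 / t ^ 4) : ℂ) =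
      -((((1 + r₀ ^ 2) * ρ₀ ^ 2) ^ 2 / t ^ 4 : ℝ) : ℂ) := by
    push_cast
    ring
  -- The argument is real and at most `0`, hence in the slit plane even when it lies outside the
  -- unit disc, so uniqueness of the continuation applies.
  have hF' : F (-((((1 + r₀ ^ 2) * ρ₀ ^ 2) ^ 2 / t ^ 4 : ℝ) : ℂ)) =
      EguchiHanson.eulerIntegral (-((((1 + r₀ ^ 2) * ρ₀ ^ 2) ^ 2 / t ^ 4 : ℝ) : ℂ)) := by
    refine hF.eqOn EguchiHanson.isHypergeometric_eulerIntegral (Or.inr ?_)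
    rw [Complex.neg_re, Complex.ofReal_re]
    have : 0 ≤ ((1 + r₀ ^ 2) * ρ₀ ^ 2) ^ 2 / t ^ 4 := by positivity
    linarith
  rw [hx, hF', EguchiHanson.eulerIntegral_neg_ofReal (by positivity),
    EguchiHanson.fibreDist_eq ht]
  push_cast
  ring
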